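/- Let $\nu$ be a L\'evy measure on $\mathbb R$, i.e. a Borel measure with $\nu(\{0\})=0$ and $\int_{|z|<1}|z|^2\,\nu(dz)+\int_{|z|\ge 1}\nu(dz)<\infty$. Assume: (A1) there are $p\in(0,2)$ and $C>0$ such that $\int_{|z|\le\delta}|z|^2\,\nu(dz)\ge C\,\delta^{2-p}$ for every $0<\delta\le 1$; (A3) there is $q>0$ such that $\int_{|z|>1}|z|^q\,\nu(dz)<\infty$; (A2) at least one of the following holds: (i) the exponent $p$ in (A1) lies in $(1,2)$; (ii) $\mathbb R=\bigcup_{n\ge 0}\big(\underbrace{\operatorname{supp}\nu+\dots+\operatorname{supp}\nu}_{n}\big)$, where the empty sum ($n=0$) is $\{0\}$. Let $\mathcal I$ be the generator of the Ornstein--Uhlenbeck process driven by the pure-jump L\'evy process with L\'evy measure $\nu$, $$\mathcal I[y,f]=-f'(y)\,y+\int_{\mathbb R}\big(f(y+z)-f(y)-f'(y)\,z\,\mathbf 1_{\{|z|\le 1\}}\big)\,\nu(dz).$$ A viscosity subsolution (resp. supersolution) of $-\mathcal I[y,V]=0$ on $\mathbb R$ is an upper (resp. lower) semicontinuous function $V:\mathbb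 R\to\mathbb R$ such that $-\mathcal I[y,\varphi]\le 0$ (resp. $\ge 0$) for every $y\in\mathbb R$ and every $\varphi\in C^2(\mathbb R)$ for which $V-\varphi$ has a global maximum (resp. minimum) at $y$ and the integrand in $\mathcal I[y,\varphi]$ is $\nu$-integrable. Then: 1. every bounded viscosity subsolution of $-\mathcal I[y,V]=0$ on $\mathbb R$ is constant; 2. every bounded viscosity supersolution of $-\mathcal I[y,V]=0$ on $\mathbb R$ is constant. -/

import Mathlib

open MeasureTheory Set

noncomputable section

namespace LevyOU

/-- A Lévy measure on the real line: no mass at the origin, and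
`∫_{|z| < 1} |z|² ν(dz) + ∫_{|z| ≥ 1} ν(dz) < ∞`. -/
structure IsLevyMeasure (ν : Measure ℝ) : Prop where
  zero_mass : ν {0} = 0
  integrability :
    (∫⁻ z in {z : ℝ | |z| < 1}, ENNReal.ofReal (|z| ^ 2) ∂ν) + ν {z : ℝ | 1 ≤ |z|} < ⊤

/-- Nondegeneracy at the origin with exponent `p ∈ (0,2)`: there is `C > 0` such that
`∫_{|z| ≤ δ} |z|² ν(dz) ≥ C δ^(2-p)` for all `0 < δ ≤ 1`. -/
def Nondegenerate (ν : Measure ℝ) (p : ℝ) : Prop :=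
  p ∈ Ioo (0 : ℝ) 2 ∧ ∃ C : ℝ, 0 < C ∧ ∀ δ : ℝ, 0 < δ → δ ≤ 1 →
    ENNReal.ofReal (C * δ ^ (2 - p)) ≤
      ∫⁻ z in {z : ℝ | |z| ≤ δ}, ENNReal.ofReal (|z| ^ 2) ∂ν

/-- Moment condition at infinity: `∫_{|z| > 1} |z|^q ν(dz) < ∞` for some `q > 0`. -/
def HasMomentAtInfinity (ν : Measure ℝ) : Prop :=
  ∃ q : ℝ, 0 < q ∧ (∫⁻ z in {z : ℝ | 1 < |z|}, ENNReal.ofReal (|z| ^ q) ∂ν) < ⊤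

/-- The `n`-fold Minkowski sum `S + ⋯ + S` (equal to `{0}` for `n = 0`). -/
def nfoldSum (S : Set ℝ) (n : ℕ) : Set ℝ :=
  {x | ∃ s : Fin n → ℝ, (∀ i, s i ∈ S) ∧ x = ∑ i, s i}

/-- The real line is covered by the iterated Minkowski sums of the support of `ν`. -/
def SupportCovers (ν : Measure ℝ) : Prop :=
  (univ : Set ℝ) = ⋃ n : ℕ, nfoldSum ν.support n

/-- The integrand `f(y+z) - f(y) - f'(y) z 1_{|z| ≤ 1}` of the nonlocal term at `y`. -/
def jumpIntegrand (f : ℝ → ℝ) (y z : ℝ) : ℝ :=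
  f (y + z) - f y - deriv f y * {z : ℝ | |z| ≤ 1}.indicator (fun z => z) z

/-- The generator of the Ornstein-Uhlenbeck process driven by the pure jump Lévy process with
Lévy measure `ν`:
`I[y, f] = - f'(y) y + ∫ (f(y+z) - f(y) - f'(y) z 1_{|z| ≤ 1}) ν(dz)`. -/
def generator (ν : Measure ℝ) (f : ℝ → ℝ) (y : ℝ) : ℝ :=
  -(deriv f y * y) + ∫ z, jumpIntegrand f y z ∂ν

/-- Viscosity subsolutions of `-I[y, V] = 0` on `ℝ`: `V` is upper semicontinuous, and
`-I[y, φ] ≤ 0` whenever `φ` is `C²`, `V - φ` has a global maximum at `y`, and the nonlocal term of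
`φ` at `y` is finite. For bounded `V` the negative part of that term is always finite at such a
point, and where the term is `+∞` the inequality holds trivially, so no test function is lost. -/
def IsViscositySubsolution (ν : Measure ℝ) (V : ℝ → ℝ) : Prop :=
  UpperSemicontinuous V ∧
    ∀ (φ : ℝ → ℝ) (y : ℝ), ContDiff ℝ 2 φ → Integrable (jumpIntegrand φ y) ν →
      (∀ x, V x - φ x ≤ V y - φ y) → -generator ν φ y ≤ 0

/-- Viscosity supersolutions of `-I[y, V] = 0` on `ℝ`: `V` is lower semicontinuous, and
`-I[y, φ] ≥ 0` whenever `φ` is `C²`, `V - φ` has a global minimum at `y`, and the nonlocal term of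
`φ` at `y` is finite. -/
def IsViscositySupersolution (ν : Measure ℝ) (V : ℝ → ℝ) : Prop :=
  LowerSemicontinuous V ∧
    ∀ (φ : ℝ → ℝ) (y : ℝ), ContDiff ℝ 2 φ → Integrable (jumpIntegrand φ y) ν →
      (∀ x, V y - φ y ≤ V x - φ x) → 0 ≤ -generator ν φ y

end LevyOU

end

open Filter Topology

namespace LevyOU

variable {ν : Measure ℝ} {f φ V : ℝ → ℝ}

/-! ### Integrability against a Lévy measure -/

lemma IsLevyMeasure.measure_one_le_lt_top (hν : IsLevyMeasure ν) : ν {z : ℝ | 1 ≤ |z|} < ⊤ :=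
  lt_of_le_of_lt le_add_self hν.integrability

lemma measurableSet_abs_le (δ : ℝ) : MeasurableSet {z : ℝ | |z| ≤ δ} :=
  measurableSet_le (by fun_prop) (by fun_prop)

lemma measurableSet_le_abs (δ : ℝ) : MeasurableSet {z : ℝ | δ ≤ |z|} :=
  measurableSet_le (by fun_prop) (by fun_prop)

lemma measurableSet_lt_abs (δ : ℝ) : MeasurableSet {z : ℝ | δ < |z|} :=
  measurableSet_lt (by fun_prop) (by fun_prop)

lemma IsLevyMeasure.lintegral_sq_lt_top (hν : IsLevyMeasure ν) :
    ∫⁻ z in {z : ℝ | |z| ≤ 1}, ENNReal.ofReal (|z| ^ 2) ∂ν < ⊤ := by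
  have hsub : {z : ℝ | |z| ≤ 1} ⊆ {z : ℝ | |z| < 1} ∪ {z : ℝ | |z| = 1} := by
    intro z hz
    rcases lt_or_eq_of_le (show |z| ≤ 1 from hz) with h | h
    · exact Or.inl h
    · exact Or.inr h
  refine lt_of_le_of_lt (lintegral_mono_set hsub) ?_
  refine lt_of_le_of_lt (lintegral_union_le _ _ _) ?_
  refine ENNReal.add_lt_top.2 ⟨lt_of_le_of_lt le_self_add hν.integrability, ?_⟩
  have hm : MeasurableSet {z : ℝ | |z| = 1} :=
    measurableSet_eq_fun (by fun_prop) (by fun_prop)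
  calc ∫⁻ z in {z : ℝ | |z| = 1}, ENNReal.ofReal (|z| ^ 2) ∂ν
      = ∫⁻ z in {z : ℝ | |z| = 1}, 1 ∂ν := by
        refine setLIntegral_congr_fun hm ?_
        intro z hz
        have : |z| = 1 := hz
        simp [this]
    _ = ν {z : ℝ | |z| = 1} := by simp
    _ ≤ ν {z : ℝ | 1 ≤ |z|} := measure_mono fun z hz => ge_of_eq hz
    _ < ⊤ := hν.measure_one_le_lt_top

lemma IsLevyMeasure.integrableOn_sq (hν : IsLevyMeasure ν) :
    IntegrableOn (fun z : ℝ => z ^ 2) {z : ℝ | |z| ≤ 1} ν := by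
  refine ⟨by fun_prop, ?_⟩
  rw [hasFiniteIntegral_iff_ofReal (Eventually.of_forall fun z => sq_nonneg z)]
  simpa only [sq_abs] using hν.lintegral_sq_lt_top

lemma IsLevyMeasure.measure_le_abs_lt_top (hν : IsLevyMeasure ν) {δ : ℝ} (hδ : 0 < δ) :
    ν {z : ℝ | δ ≤ |z|} < ⊤ := by
  have hsub : {z : ℝ | δ ≤ |z|} ⊆ {z : ℝ | |z| ≤ 1 ∧ δ ≤ |z|} ∪ {z : ℝ | 1 ≤ |z|} := by
    intro z hz
    rcases le_total |z| 1 with h | h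
    · exact Or.inl ⟨h, hz⟩
    · exact Or.inr h
  refine lt_of_le_of_lt (measure_mono hsub) (lt_of_le_of_lt (measure_union_le _ _) ?_)
  refine ENNReal.add_lt_top.2 ⟨?_, hν.measure_one_le_lt_top⟩
  have hc : (0 : ENNReal) < ENNReal.ofReal (δ ^ 2) := ENNReal.ofReal_pos.2 (by positivity)
  have h1 : ENNReal.ofReal (δ ^ 2) * ν {z : ℝ | |z| ≤ 1 ∧ δ ≤ |z|} ≤
      ∫⁻ z in {z : ℝ | |z| ≤ 1}, ENNReal.ofReal (|z| ^ 2) ∂ν := by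
    calc ENNReal.ofReal (δ ^ 2) * ν {z : ℝ | |z| ≤ 1 ∧ δ ≤ |z|}
        = ∫⁻ _ in {z : ℝ | |z| ≤ 1 ∧ δ ≤ |z|}, ENNReal.ofReal (δ ^ 2) ∂ν := by simp
      _ ≤ ∫⁻ z in {z : ℝ | |z| ≤ 1 ∧ δ ≤ |z|}, ENNReal.ofReal (|z| ^ 2) ∂ν := by
          refine setLIntegral_mono' ((measurableSet_abs_le 1).inter (measurableSet_le_abs δ)) ?_
          intro z hz
          exact ENNReal.ofReal_le_ofReal (pow_le_pow_left₀ hδ.le hz.2 2)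
      _ ≤ _ := lintegral_mono_set fun z hz => hz.1
  by_contra h
  rw [not_lt_top_iff] at h
  rw [h, ENNReal.mul_top hc.ne'] at h1
  exact absurd hν.lintegral_sq_lt_top (not_lt.2 h1)

/-- A dominating function for the nonlocal term. -/
noncomputable def jumpBound (B : ℝ) (G : ℝ → ℝ) (z : ℝ) : ℝ :=
  {z : ℝ | |z| ≤ 1}.indicator (fun z => B * z ^ 2) z + {z : ℝ | 1 < |z|}.indicator G z

lemma IsLevyMeasure.integrable_jumpBound (hν : IsLevyMeasure ν) (B : ℝ) {G : ℝ → ℝ}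
    (hG : IntegrableOn G {z : ℝ | 1 < |z|} ν) : Integrable (jumpBound B G) ν := by
  refine Integrable.add ?_ ?_
  · rw [integrable_indicator_iff (measurableSet_abs_le 1)]
    exact hν.integrableOn_sq.const_mul B
  · rwa [integrable_indicator_iff (measurableSet_lt_abs 1)]

lemma IsLevyMeasure.integrableOn_const (hν : IsLevyMeasure ν) (c : ℝ) :
    IntegrableOn (fun _ => c) {z : ℝ | 1 < |z|} ν := by
  refine MeasureTheory.integrableOn_const (lt_of_le_of_lt (measure_mono ?_) hν.measure_one_le_lt_top).ne
  exact fun z (hz : 1 < |z|) => hz.le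

lemma measurable_jumpIntegrand (hf : Continuous f) (y : ℝ) : Measurable (jumpIntegrand f y) := by
  unfold jumpIntegrand
  exact ((hf.comp (continuous_const.add continuous_id)).measurable.sub measurable_const).sub
    (measurable_const.mul (measurable_id.indicator (measurableSet_abs_le 1)))

/-- First-order Taylor estimate from a Lipschitz bound on the derivative at the base point. -/
lemma abs_taylor_le (hf : Differentiable ℝ f) {B y z : ℝ} (hB : 0 ≤ B)
    (h : ∀ x, |x - y| ≤ |z| → |deriv f x - deriv f y| ≤ B * |x - y|) :
    |f (y + z) - f y - deriv f y * z| ≤ B * z ^ 2 := by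
  have hd : ∀ x ∈ Metric.closedBall y |z|,
      HasDerivWithinAt (fun x => f x - deriv f y * x) (deriv f x - deriv f y)
        (Metric.closedBall y |z|) x := by
    intro x _
    have := ((hf x).hasDerivAt.sub ((hasDerivAt_id x).const_mul (deriv f y)))
    rw [mul_one] at this
    exact this.hasDerivWithinAt
  have hb : ∀ x ∈ Metric.closedBall y |z|, ‖deriv f x - deriv f y‖ ≤ B * |z| := by
    intro x hx
    rw [Metric.mem_closedBall, Real.dist_eq] at hx
    exact (h x hx).trans (mul_le_mul_of_nonneg_left hx hB)
  have := Convex.norm_image_sub_le_of_norm_hasDerivWithin_le hd hb (convex_closedBall y |z|)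
    (Metric.mem_closedBall_self (abs_nonneg z))
    (show y + z ∈ Metric.closedBall y |z| by simp)
  rw [Real.norm_eq_abs, Real.norm_eq_abs] at this
  have e : f (y + z) - deriv f y * (y + z) - (f y - deriv f y * y)
      = f (y + z) - f y - deriv f y * z := by ring
  rw [e, add_sub_cancel_left, mul_assoc, abs_mul_abs_self] at this
  rwa [sq]

lemma abs_jumpIntegrand_le (hf : Differentiable ℝ f) {B y : ℝ} {G : ℝ → ℝ} (hB : 0 ≤ B)
    (h : ∀ x, |x - y| ≤ 1 → |deriv f x - deriv f y| ≤ B * |x - y|)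
    (hG : ∀ z, 1 < |z| → |f (y + z) - f y| ≤ G z) (z : ℝ) :
    |jumpIntegrand f y z| ≤ jumpBound B G z := by
  unfold jumpIntegrand jumpBound
  by_cases hz : |z| ≤ 1
  · rw [indicator_of_mem (show z ∈ {z : ℝ | |z| ≤ 1} from hz),
      indicator_of_mem (show z ∈ {z : ℝ | |z| ≤ 1} from hz),
      indicator_of_notMem (show z ∉ {z : ℝ | 1 < |z|} from not_lt.2 hz), add_zero]
    exact abs_taylor_le hf hB fun x hx => h x (hx.trans hz)
  · rw [indicator_of_notMem (show z ∉ {z : ℝ | |z| ≤ 1} from hz),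
      indicator_of_notMem (show z ∉ {z : ℝ | |z| ≤ 1} from hz),
      indicator_of_mem (show z ∈ {z : ℝ | 1 < |z|} from not_le.1 hz), mul_zero, sub_zero, zero_add]
    exact hG z (not_le.1 hz)

/-- The derivative of a `C²` function is Lipschitz on compact intervals. -/
lemma exists_lipschitz_deriv (hf : ContDiff ℝ 2 f) (a : ℝ) :
    ∃ B, 0 ≤ B ∧ ∀ y, |y - a| ≤ 1 → ∀ x, |x - y| ≤ 1 →
      |deriv f x - deriv f y| ≤ B * |x - y| := by
  have hf' : ContDiff ℝ 1 (deriv f) := ((contDiff_succ_iff_deriv (n := 1)).1 hf).2.2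
  have hf'' : Continuous (deriv (deriv f)) := hf'.continuous_deriv le_rfl
  obtain ⟨B, hB⟩ := (isCompact_closedBall a (2 : ℝ)).exists_bound_of_continuousOn hf''.continuousOn
  refine ⟨B, (norm_nonneg _).trans (hB a (Metric.mem_closedBall_self (by norm_num))), ?_⟩
  intro y hy x hx
  refine Convex.norm_image_sub_le_of_norm_deriv_le
    (fun t _ => (hf'.differentiable one_ne_zero) t) hB (convex_closedBall a 2) ?_ ?_
  · rw [Metric.mem_closedBall, Real.dist_eq]; linarith
  · rw [Metric.mem_closedBall, Real.dist_eq]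
    have := abs_sub_le x y a
    linarith

/-- For a bounded `C²` function, the nonlocal term is finite everywhere. -/
lemma IsLevyMeasure.integrable_jumpIntegrand (hν : IsLevyMeasure ν) (hf : ContDiff ℝ 2 f) {K : ℝ}
    (hK : ∀ x, |f x| ≤ K) (y : ℝ) : Integrable (jumpIntegrand f y) ν := by
  obtain ⟨B, hB, h⟩ := exists_lipschitz_deriv hf y
  refine (hν.integrable_jumpBound B (hν.integrableOn_const (K + K))).mono'
    (measurable_jumpIntegrand hf.continuous y).aestronglyMeasurable (Eventually.of_forall ?_)
  exact abs_jumpIntegrand_le (hf.differentiable two_ne_zero) hB (h y (by simp)) fun z _ =>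
    (abs_sub _ _).trans (add_le_add (hK _) (hK _))

/-- The generator maps bounded `C²` functions to continuous functions. -/
lemma IsLevyMeasure.continuous_generator (hν : IsLevyMeasure ν) (hf : ContDiff ℝ 2 f) {K : ℝ}
    (hK : ∀ x, |f x| ≤ K) : Continuous (generator ν f) := by
  have hf' : Continuous (deriv f) := hf.continuous_deriv (by norm_num)
  refine ((hf'.mul continuous_id).neg).add ?_
  rw [continuous_iff_continuousAt]
  intro a
  obtain ⟨B, hB, h⟩ := exists_lipschitz_deriv hf a
  refine continuousAt_of_dominated
    (Eventually.of_forall fun y => (measurable_jumpIntegrand hf.continuous y).aestronglyMeasurable)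
    ?_ (hν.integrable_jumpBound B (hν.integrableOn_const (K + K))) (Eventually.of_forall ?_)
  · filter_upwards [Metric.closedBall_mem_nhds a one_pos] with y hy
    rw [Metric.mem_closedBall, Real.dist_eq] at hy
    refine Eventually.of_forall ?_
    exact abs_jumpIntegrand_le (hf.differentiable two_ne_zero) hB (h y hy) fun z _ =>
      (abs_sub _ _).trans (add_le_add (hK _) (hK _))
  · intro z
    have hc := hf.continuous
    unfold jumpIntegrand
    fun_prop

/-! ### Affine invariance of the generator -/

lemma jumpIntegrand_const_add_mul (hf : Differentiable ℝ f) (c ε y : ℝ) :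
    jumpIntegrand (fun x => c + ε * f x) y = fun z => ε * jumpIntegrand f y z := by
  have hd : deriv (fun x => c + ε * f x) y = ε * deriv f y := by
    rw [deriv_const_add, deriv_const_mul _ (hf y)]
  ext z
  simp only [jumpIntegrand, hd]
  ring

lemma generator_const_add_mul (hf : Differentiable ℝ f) (c ε y : ℝ) :
    generator ν (fun x => c + ε * f x) y = ε * generator ν f y := by
  have hd : deriv (fun x => c + ε * f x) y = ε * deriv f y := by
    rw [deriv_const_add, deriv_const_mul _ (hf y)]
  simp only [generator, hd, jumpIntegrand_const_add_mul hf, integral_const_mul]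
  ring

/-- Testing a subsolution with `c + ε f` for `ε > 0`. -/
lemma IsViscositySubsolution.generator_nonneg (hV : IsViscositySubsolution ν V)
    (hf : ContDiff ℝ 2 f) {y : ℝ} (hi : Integrable (jumpIntegrand f y) ν) {c ε : ℝ} (hε : 0 < ε)
    (hmax : ∀ x, V x - (c + ε * f x) ≤ V y - (c + ε * f y)) : 0 ≤ generator ν f y := by
  have hd := hf.differentiable two_ne_zero
  have := hV.2 (fun x => c + ε * f x) y (contDiff_const.add (contDiff_const.mul hf))
    (by rw [jumpIntegrand_const_add_mul hd]; exact hi.const_mul ε) hmax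
  rw [generator_const_add_mul hd] at this
  exact nonneg_of_mul_nonneg_right (by linarith) hε

/-! ### The logarithmic Lyapunov function -/

/-- The Lyapunov function `log (1 + y²)`. -/
noncomputable def lyapunov (y : ℝ) : ℝ := Real.log (1 + y ^ 2)

lemma contDiff_lyapunov : ContDiff ℝ 2 lyapunov :=
  (contDiff_const.add (contDiff_id.pow 2)).log fun y => (by positivity : (1 : ℝ) + id y ^ 2 ≠ 0)

lemma deriv_lyapunov (y : ℝ) : deriv lyapunov y = 2 * y / (1 + y ^ 2) := by
  have h : HasDerivAt (fun y : ℝ => 1 + y ^ 2) (2 * y) y := by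
    simpa using (hasDerivAt_pow 2 y).const_add 1
  exact (h.log (by positivity)).deriv

lemma abs_deriv_lyapunov_sub_le (x y : ℝ) :
    |deriv lyapunov x - deriv lyapunov y| ≤ 2 * |x - y| := by
  have e : deriv lyapunov x - deriv lyapunov y
      = 2 * (x - y) * ((1 - x * y) / ((1 + x ^ 2) * (1 + y ^ 2))) := by
    rw [deriv_lyapunov, deriv_lyapunov]
    field_simp
    ring
  have h : |(1 - x * y) / ((1 + x ^ 2) * (1 + y ^ 2))| ≤ 1 := by
    rw [abs_div, abs_of_pos (show 0 < (1 + x ^ 2) * (1 + y ^ 2) by positivity),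
      div_le_one (by positivity), abs_le]
    constructor <;> nlinarith [sq_nonneg (x - y), sq_nonneg (x + y), sq_nonneg (x * y)]
  rw [e, abs_mul, abs_mul, abs_two]
  exact mul_le_of_le_one_right (by positivity) h

lemma lyapunov_add_le (y z : ℝ) :
    lyapunov (y + z) ≤ Real.log 2 + lyapunov z + lyapunov y := by
  unfold lyapunov
  rw [← Real.log_mul (by norm_num) (by positivity), ← Real.log_mul (by positivity) (by positivity)]
  refine Real.log_le_log (by positivity) ?_
  nlinarith [sq_nonneg (y - z), sq_nonneg (y * z)]

lemma abs_lyapunov_add_sub_le (y z : ℝ) :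
    |lyapunov (y + z) - lyapunov y| ≤ Real.log 2 + lyapunov z := by
  have h1 := lyapunov_add_le y z
  have h2 := lyapunov_add_le (y + z) (-z)
  have h3 : lyapunov (-z) = lyapunov z := by simp [lyapunov]
  rw [add_neg_cancel_right, h3] at h2
  rw [abs_le]
  constructor <;> linarith

lemma lyapunov_le_rpow {q z : ℝ} (hq : 0 < q) (hz : 1 < |z|) :
    lyapunov z ≤ Real.log 2 + 2 / q * |z| ^ q := by
  have hz0 : 0 < |z| := one_pos.trans hz
  calc lyapunov z ≤ Real.log (2 * |z| ^ 2) := by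
        refine Real.log_le_log (by positivity) ?_
        rw [← sq_abs z]
        nlinarith
    _ = Real.log 2 + 2 * Real.log |z| := by
        rw [Real.log_mul (by norm_num) (by positivity), Real.log_pow]
        norm_num
    _ ≤ Real.log 2 + 2 * (|z| ^ q / q) := by
        gcongr
        exact Real.log_le_rpow_div hz0.le hq
    _ = _ := by ring

lemma HasMomentAtInfinity.exists_lyapunov_bound (hν : IsLevyMeasure ν)
    (h : HasMomentAtInfinity ν) : ∃ G : ℝ → ℝ, IntegrableOn G {z : ℝ | 1 < |z|} ν ∧
      ∀ y z, 1 < |z| → |lyapunov (y + z) - lyapunov y| ≤ G z := by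
  obtain ⟨q, hq, hfin⟩ := h
  refine ⟨fun z => 2 * Real.log 2 + 2 / q * |z| ^ q, ?_, ?_⟩
  · refine (hν.integrableOn_const _).add (Integrable.const_mul ⟨?_, ?_⟩ _)
    · exact (Measurable.pow_const (by fun_prop) q).aestronglyMeasurable
    · rwa [hasFiniteIntegral_iff_ofReal (Eventually.of_forall fun z => by positivity)]
  · intro y z hz
    have := abs_lyapunov_add_sub_le y z
    have := lyapunov_le_rpow hq hz
    linarith

lemma tendsto_one_add_sq_cocompact :
    Tendsto (fun y : ℝ => 1 + y ^ 2) (cocompact ℝ) atTop := by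
  refine tendsto_atTop_add_const_left _ _ ?_
  have := (tendsto_pow_atTop two_ne_zero).comp (tendsto_norm_cocompact_atTop (E := ℝ))
  simpa [Function.comp_def] using this

lemma tendsto_lyapunov_cocompact : Tendsto lyapunov (cocompact ℝ) atTop :=
  Real.tendsto_log_atTop.comp tendsto_one_add_sq_cocompact

lemma tendsto_deriv_lyapunov_cocompact : Tendsto (deriv lyapunov) (cocompact ℝ) (𝓝 0) := by
  have h : Tendsto (fun y : ℝ => 2 * ‖y‖⁻¹) (cocompact ℝ) (𝓝 0) := by
    simpa using (tendsto_inv_atTop_zero.comp (tendsto_norm_cocompact_atTop (E := ℝ))).const_mul 2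
  refine squeeze_zero_norm (fun y => ?_) h
  rw [deriv_lyapunov, norm_div, norm_mul, Real.norm_ofNat, Real.norm_eq_abs, Real.norm_eq_abs,
    abs_of_pos (show 0 < 1 + y ^ 2 by positivity), mul_div_assoc]
  gcongr
  rcases eq_or_ne y 0 with rfl | hy
  · simp
  · have : 0 < |y| := abs_pos.2 hy
    rw [div_le_iff₀ (by positivity), ← sq_abs y]
    field_simp
    linarith

lemma tendsto_lyapunov_add_sub_cocompact (z : ℝ) :
    Tendsto (fun y => lyapunov (y + z) - lyapunov y) (cocompact ℝ) (𝓝 0) := by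
  have h1 : Tendsto (fun y : ℝ => 1 + (z * deriv lyapunov y + z ^ 2 * (1 + y ^ 2)⁻¹))
      (cocompact ℝ) (𝓝 1) := by
    simpa using ((tendsto_deriv_lyapunov_cocompact.const_mul z).add
      ((tendsto_inv_atTop_zero.comp tendsto_one_add_sq_cocompact).const_mul (z ^ 2))).const_add 1
  have h2 := h1.log one_ne_zero
  rw [Real.log_one] at h2
  refine h2.congr fun y => ?_
  unfold lyapunov
  rw [← Real.log_div (by positivity) (by positivity)]
  congr 1
  have := deriv_lyapunov y
  unfold lyapunov at this
  rw [this]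
  field_simp
  ring

lemma IsLevyMeasure.integrable_jumpIntegrand_lyapunov (hν : IsLevyMeasure ν)
    (h : HasMomentAtInfinity ν) (y : ℝ) : Integrable (jumpIntegrand lyapunov y) ν := by
  obtain ⟨G, hG, hb⟩ := h.exists_lyapunov_bound hν
  refine (hν.integrable_jumpBound 2 hG).mono'
    (measurable_jumpIntegrand contDiff_lyapunov.continuous y).aestronglyMeasurable
    (Eventually.of_forall ?_)
  exact abs_jumpIntegrand_le (contDiff_lyapunov.differentiable two_ne_zero) zero_le_two
    (fun x _ => abs_deriv_lyapunov_sub_le x y) (hb y)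

lemma IsLevyMeasure.tendsto_generator_lyapunov (hν : IsLevyMeasure ν)
    (h : HasMomentAtInfinity ν) :
    Tendsto (generator ν lyapunov) (cocompact ℝ) (𝓝 (-2)) := by
  obtain ⟨G, hG, hb⟩ := h.exists_lyapunov_bound hν
  have hdrift : Tendsto (fun y => -(deriv lyapunov y * y)) (cocompact ℝ) (𝓝 (-2)) := by
    have : Tendsto (fun y : ℝ => -2 + 2 * (1 + y ^ 2)⁻¹) (cocompact ℝ) (𝓝 (-2)) := by
      simpa using ((tendsto_inv_atTop_zero.comp
        tendsto_one_add_sq_cocompact).const_mul 2).const_add (-2)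
    refine this.congr fun y => ?_
    rw [deriv_lyapunov]
    field_simp
    ring
  have hjump : Tendsto (fun y => ∫ z, jumpIntegrand lyapunov y z ∂ν) (cocompact ℝ)
      (𝓝 (∫ _, (0 : ℝ) ∂ν)) := by
    have : (cocompact ℝ).IsCountablyGenerated := by
      rw [cocompact_eq_atBot_atTop]
      infer_instance
    refine tendsto_integral_filter_of_dominated_convergence (jumpBound 2 G)
      (Eventually.of_forall fun y =>
        (measurable_jumpIntegrand contDiff_lyapunov.continuous y).aestronglyMeasurable)
      (Eventually.of_forall fun y => Eventually.of_forall ?_)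
      (hν.integrable_jumpBound 2 hG) (Eventually.of_forall fun z => ?_)
    · exact abs_jumpIntegrand_le (contDiff_lyapunov.differentiable two_ne_zero) zero_le_two
        (fun x _ => abs_deriv_lyapunov_sub_le x y) (hb y)
    · simpa only [jumpIntegrand, zero_mul, sub_zero] using (tendsto_lyapunov_add_sub_cocompact z).sub
        (tendsto_deriv_lyapunov_cocompact.mul_const
          ({z : ℝ | |z| ≤ 1}.indicator (fun z => z) z))
  have := hdrift.add hjump
  rw [integral_zero, add_zero] at this
  exact this

/-! ### Bounded subsolutions attain their maximum -/

/-- An upper semicontinuous function bounded above attains its maximum after subtracting a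
continuous function tending to infinity. -/
lemma exists_forall_sub_le (hV : UpperSemicontinuous V) {K : ℝ} (hK : ∀ x, V x ≤ K)
    (hf : Continuous f) (hlim : Tendsto f (cocompact ℝ) atTop) :
    ∃ y, ∀ x, V x - f x ≤ V y - f y := by
  obtain ⟨R, hR⟩ := (Metric.mem_cocompact_iff_closedBall_compl_subset (0 : ℝ)).1
    (hlim.eventually_ge_atTop (K - (V 0 - f 0)))
  have husc : UpperSemicontinuous (fun x => V x - f x) := by
    simpa [sub_eq_add_neg] using hV.add hf.neg.upperSemicontinuous
  obtain ⟨y, -, hy⟩ := (husc.upperSemicontinuousOn (Metric.closedBall 0 |R|)).exists_isMaxOn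
    ⟨0, Metric.mem_closedBall_self (abs_nonneg R)⟩ (isCompact_closedBall _ _)
  have h0 : V 0 - f 0 ≤ V y - f y := hy (Metric.mem_closedBall_self (abs_nonneg R))
  refine ⟨y, fun x => ?_⟩
  by_cases hx : x ∈ Metric.closedBall (0 : ℝ) |R|
  · exact hy hx
  · have hx' : x ∈ (Metric.closedBall (0 : ℝ) R)ᶜ := fun h =>
      hx (Metric.closedBall_subset_closedBall (le_abs_self R) h)
    have : K - (V 0 - f 0) ≤ f x := hR hx'
    linarith [hK x]

/-- A bounded subsolution attains its maximum. -/
lemma IsViscositySubsolution.exists_forall_le (hν : IsLevyMeasure ν) (h : HasMomentAtInfinity ν)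
    (hV : IsViscositySubsolution ν V) {K : ℝ} (hK : ∀ x, V x ≤ K) :
    ∃ y, ∀ x, V x ≤ V y := by
  obtain ⟨R, hR⟩ := (Metric.mem_cocompact_iff_closedBall_compl_subset (0 : ℝ)).1
    ((hν.tendsto_generator_lyapunov h).eventually_lt_const (show (-2 : ℝ) < 0 by norm_num))
  obtain ⟨m, -, hm⟩ := (hV.1.upperSemicontinuousOn (Metric.closedBall 0 |R|)).exists_isMaxOn
    ⟨0, Metric.mem_closedBall_self (abs_nonneg R)⟩ (isCompact_closedBall _ _)
  refine ⟨m, fun x => ?_⟩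
  have key : ∀ ε : ℝ, 0 < ε → V x ≤ V m + ε * lyapunov x := by
    intro ε hε
    obtain ⟨y, hy⟩ := exists_forall_sub_le (f := fun x => 0 + ε * lyapunov x) hV.1 hK
      (continuous_const.add (continuous_const.mul contDiff_lyapunov.continuous))
      (by simpa using tendsto_lyapunov_cocompact.const_mul_atTop hε)
    have hg := hV.generator_nonneg contDiff_lyapunov
      (hν.integrable_jumpIntegrand_lyapunov h y) hε hy
    have hyR : y ∈ Metric.closedBall (0 : ℝ) |R| := by
      by_contra hcon
      have : generator ν lyapunov y < 0 := hR fun h =>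
        hcon (Metric.closedBall_subset_closedBall (le_abs_self R) h)
      linarith
    have h1 : V y ≤ V m := hm hyR
    have h2 : 0 ≤ lyapunov y := Real.log_nonneg (by nlinarith [sq_nonneg y])
    have h3 := hy x
    have h4 := mul_nonneg hε.le h2
    linarith
  have hlim : Tendsto (fun ε : ℝ => V m + ε * lyapunov x) (𝓝[>] 0) (𝓝 (V m)) := by
    have : Continuous fun ε : ℝ => V m + ε * lyapunov x := by fun_prop
    simpa using (this.tendsto 0).mono_left nhdsWithin_le_nhds
  exact ge_of_tendsto hlim (eventually_nhdsWithin_of_forall key)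

/-! ### Propagation of maxima along jumps -/

/-- A maximum of a subsolution propagates to all points reached by one jump. -/
lemma IsViscositySubsolution.eq_of_mem_support (hν : IsLevyMeasure ν)
    (hV : IsViscositySubsolution ν V) {y z : ℝ} (hmax : ∀ x, V x ≤ V y) (hz : z ∈ ν.support) :
    V (y + z) = V y := by
  by_contra hne
  have hlt : V (y + z) < V y := lt_of_le_of_ne (hmax _) hne
  have hz0 : 0 < |z| := abs_pos.2 fun h => hne (by rw [h, add_zero])
  obtain ⟨m, hm1, hm2⟩ := exists_between hlt
  obtain ⟨r₀, hr₀, hball⟩ := Metric.eventually_nhds_iff_ball.1 (hV.1 (y + z) m hm1)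
  set r := min r₀ |z|
  have hrpos : 0 < r := lt_min hr₀ hz0
  let b : ContDiffBump (y + z) := ⟨r / 2, r, by linarith, by linarith⟩
  have hb : ContDiff ℝ 2 (fun x => -b x) := b.contDiff.neg
  have hby : b y = 0 := b.zero_of_le_dist (by
    rw [dist_self_add_right]
    exact min_le_right r₀ |z|)
  have hi : Integrable (jumpIntegrand (fun x => -b x) y) ν :=
    hν.integrable_jumpIntegrand hb (K := 1)
      (fun x => by rw [abs_neg, abs_of_nonneg b.nonneg]; exact b.le_one) y
  have hg := hV.generator_nonneg hb hi (c := V y) (sub_pos.2 hm2) (by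
    intro x
    rw [hby]
    by_cases hx : dist x (y + z) < r
    · have h1 : V x < m := hball x (hx.trans_le (min_le_left _ _))
      have h2 := mul_le_mul_of_nonneg_left (b.le_one (x := x)) (sub_pos.2 hm2).le
      linarith
    · rw [b.zero_of_le_dist (not_lt.1 hx)]
      linarith [hmax x])
  have hder : deriv (fun x => -b x) y = 0 := by
    refine IsLocalMax.deriv_eq_zero (Eventually.of_forall fun x => ?_)
    simp only [hby]
    linarith [b.nonneg (x := x)]
  have hj : jumpIntegrand (fun x => -b x) y = fun t => -b (y + t) := by
    ext t
    simp only [jumpIntegrand, hder, hby]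
    ring
  rw [hj] at hi
  have hpos : 0 < ∫ t, b (y + t) ∂ν := by
    rw [integral_pos_iff_support_of_nonneg (fun t => b.nonneg) (by simpa using hi.neg)]
    refine ((Measure.mem_support_iff_forall z).1 hz _ (Metric.ball_mem_nhds z hrpos)).trans_le
      (measure_mono fun t ht => ?_)
    refine (b.pos_of_mem_ball ?_).ne'
    simpa [b] using ht
  rw [generator, hder, hj, integral_neg] at hg
  linarith

/-- A closed set stable under arbitrarily small positive translations is an upper set. -/
lemma mem_of_le_of_small_steps {S T : Set ℝ} (hS : IsClosed S)
    (hST : ∀ y ∈ S, ∀ t ∈ T, y + t ∈ S) (hT : ∀ δ > 0, ∃ t ∈ T, 0 < t ∧ t < δ)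
    {x y : ℝ} (hy : y ∈ S) (hyx : y ≤ x) : x ∈ S := by
  have hne : (S ∩ Icc y x).Nonempty := ⟨y, hy, le_rfl, hyx⟩
  have hbdd : BddAbove (S ∩ Icc y x) := ⟨x, fun t ht => ht.2.2⟩
  have hmem := (hS.inter isClosed_Icc).csSup_mem hne hbdd
  set s := sSup (S ∩ Icc y x)
  rcases eq_or_lt_of_le hmem.2.2 with h | h
  · exact h ▸ hmem.1
  · obtain ⟨t, htT, ht0, htx⟩ := hT (x - s) (sub_pos.2 h)
    have := le_csSup hbdd
      (show s + t ∈ S ∩ Icc y x from ⟨hST s hmem.1 t htT, by linarith [hmem.2.1], by linarith⟩)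
    linarith

/-- A closed set stable under arbitrarily small negative translations is a lower set. -/
lemma mem_of_ge_of_small_steps {S T : Set ℝ} (hS : IsClosed S)
    (hST : ∀ y ∈ S, ∀ t ∈ T, y + t ∈ S) (hT : ∀ δ > 0, ∃ t ∈ T, -δ < t ∧ t < 0)
    {x y : ℝ} (hy : y ∈ S) (hxy : x ≤ y) : x ∈ S := by
  have := mem_of_le_of_small_steps (S := Neg.neg ⁻¹' S) (T := Neg.neg ⁻¹' T) (x := -x) (y := -y)
    (hS.preimage continuous_neg)
    (fun y hy t ht => by simpa [neg_add, add_comm] using hST (-y) hy (-t) ht)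
    (fun δ hδ => by
      obtain ⟨t, htT, h1, h2⟩ := hT δ hδ
      exact ⟨-t, by simpa using htT, by linarith, by linarith⟩)
    (by simpa using hy) (by linarith)
  simpa using this

/-- A set stable under translations by `T` is stable under translations by the iterated sums. -/
lemma add_mem_of_mem_nfoldSum {S T : Set ℝ} (hST : ∀ y ∈ S, ∀ t ∈ T, y + t ∈ S) (n : ℕ) :
    ∀ x ∈ nfoldSum T n, ∀ y ∈ S, y + x ∈ S := by
  induction n with
  | zero =>
    rintro x ⟨s, -, rfl⟩ y hy
    simpa using hy
  | succ n ih =>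
    rintro x ⟨s, hs, rfl⟩ y hy
    rw [Fin.sum_univ_castSucc, ← add_assoc]
    exact hST _ (ih _ ⟨fun i => s i.castSucc, fun i => hs _, rfl⟩ y hy) _ (hs _)

/-! ### Infinite variation -/

lemma Nondegenerate.lintegral_abs_eq_top {p : ℝ} (h : Nondegenerate ν p) (hp : 1 < p) :
    ∫⁻ z in {z : ℝ | |z| ≤ 1}, ENNReal.ofReal |z| ∂ν = ⊤ := by
  obtain ⟨-, C, hC, hδ⟩ := h
  by_contra hfin
  set A := (∫⁻ z in {z : ℝ | |z| ≤ 1}, ENNReal.ofReal |z| ∂ν).toReal with hA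
  have key : ∀ δ ∈ Ioc (0 : ℝ) 1, C ≤ A * δ ^ (p - 1) := by
    rintro δ ⟨hδ0, hδ1⟩
    have h1 : ENNReal.ofReal (C * δ ^ (2 - p)) ≤ ENNReal.ofReal (δ * A) := by
      calc ENNReal.ofReal (C * δ ^ (2 - p))
          ≤ ∫⁻ z in {z : ℝ | |z| ≤ δ}, ENNReal.ofReal (|z| ^ 2) ∂ν := hδ δ hδ0 hδ1
        _ ≤ ∫⁻ z in {z : ℝ | |z| ≤ δ}, ENNReal.ofReal δ * ENNReal.ofReal |z| ∂ν := by
            refine setLIntegral_mono' (measurableSet_abs_le δ) fun z hz => ?_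
            rw [← ENNReal.ofReal_mul hδ0.le, sq]
            exact ENNReal.ofReal_le_ofReal (mul_le_mul_of_nonneg_right hz (abs_nonneg z))
        _ ≤ ∫⁻ z in {z : ℝ | |z| ≤ 1}, ENNReal.ofReal δ * ENNReal.ofReal |z| ∂ν :=
            lintegral_mono_set fun z (hz : |z| ≤ δ) => hz.trans hδ1
        _ = ENNReal.ofReal δ * ∫⁻ z in {z : ℝ | |z| ≤ 1}, ENNReal.ofReal |z| ∂ν :=
            lintegral_const_mul' _ _ ENNReal.ofReal_ne_top
        _ = ENNReal.ofReal (δ * A) := by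
            rw [ENNReal.ofReal_mul hδ0.le, hA, ENNReal.ofReal_toReal hfin]
    have h2 : C * δ ^ (2 - p) ≤ δ * A :=
      (ENNReal.ofReal_le_ofReal_iff (mul_nonneg hδ0.le ENNReal.toReal_nonneg)).1 h1
    have h3 : δ ^ (2 - p) * δ ^ (p - 1) = δ := by
      rw [← Real.rpow_add hδ0]
      norm_num
    have h4 : C * δ ≤ A * δ ^ (p - 1) * δ := by
      calc C * δ = C * δ ^ (2 - p) * δ ^ (p - 1) := by rw [mul_assoc, h3]
        _ ≤ δ * A * δ ^ (p - 1) := mul_le_mul_of_nonneg_right h2 (by positivity)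
        _ = _ := by ring
    exact le_of_mul_le_mul_right h4 hδ0
  have hlim : Tendsto (fun δ : ℝ => A * δ ^ (p - 1)) (𝓝[>] 0) (𝓝 0) := by
    have hc := (Real.continuous_rpow_const (q := p - 1) (by linarith)).tendsto 0
    rw [Real.zero_rpow (by linarith)] at hc
    simpa using (hc.mono_left nhdsWithin_le_nhds).const_mul A
  have : C ≤ 0 := ge_of_tendsto hlim (by
    filter_upwards [Ioc_mem_nhdsGT (zero_lt_one' ℝ)] with δ hδ using key δ hδ)
  linarith

lemma IsLevyMeasure.lintegral_Ioc_eq_top (hν : IsLevyMeasure ν)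
    (hvar : ∫⁻ z in {z : ℝ | |z| ≤ 1}, ENNReal.ofReal |z| ∂ν = ⊤)
    {δ : ℝ} (hδ : 0 < δ) (hneg : ν (Ioo (-δ) 0) = 0) :
    ∫⁻ z in Ioc 0 1, ENNReal.ofReal z ∂ν = ⊤ := by
  have hsub : {z : ℝ | |z| ≤ 1} ⊆
      ((Ioo (-δ) 0 ∪ {0}) ∪ {z : ℝ | |z| ≤ 1 ∧ δ ≤ |z|}) ∪ Ioc 0 1 := by
    intro z (hz : |z| ≤ 1)
    rcases lt_trichotomy z 0 with h | h | h
    · by_cases hzδ : -δ < z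
      · exact Or.inl (Or.inl (Or.inl ⟨hzδ, h⟩))
      · exact Or.inl (Or.inr ⟨hz, by rw [abs_of_neg h]; linarith⟩)
    · exact Or.inl (Or.inl (Or.inr h))
    · exact Or.inr ⟨h, (le_abs_self z).trans hz⟩
  have hnull : ∫⁻ z in Ioo (-δ) 0 ∪ {0}, ENNReal.ofReal |z| ∂ν = 0 :=
    setLIntegral_measure_zero _ _ (measure_union_null hneg hν.zero_mass)
  have hmid : ∫⁻ z in {z : ℝ | |z| ≤ 1 ∧ δ ≤ |z|}, ENNReal.ofReal |z| ∂ν < ⊤ := by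
    calc ∫⁻ z in {z : ℝ | |z| ≤ 1 ∧ δ ≤ |z|}, ENNReal.ofReal |z| ∂ν
        ≤ ∫⁻ _ in {z : ℝ | |z| ≤ 1 ∧ δ ≤ |z|}, 1 ∂ν := by
          refine setLIntegral_mono' ((measurableSet_abs_le 1).inter (measurableSet_le_abs δ)) ?_
          intro z hz
          simpa using hz.1
      _ = ν {z : ℝ | |z| ≤ 1 ∧ δ ≤ |z|} := by simp
      _ ≤ ν {z : ℝ | δ ≤ |z|} := measure_mono fun z hz => hz.2
      _ < ⊤ := hν.measure_le_abs_lt_top hδ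
  have hpos : ∫⁻ z in Ioc 0 1, ENNReal.ofReal |z| ∂ν = ∫⁻ z in Ioc 0 1, ENNReal.ofReal z ∂ν :=
    setLIntegral_congr_fun measurableSet_Ioc fun z hz => by rw [abs_of_pos hz.1]
  by_contra hfin
  have hlt : ∫⁻ z in {z : ℝ | |z| ≤ 1}, ENNReal.ofReal |z| ∂ν < ⊤ := by
    refine (lintegral_mono_set hsub).trans_lt ((lintegral_union_le _ _ _).trans_lt ?_)
    rw [hpos]
    refine ENNReal.add_lt_top.2 ⟨(lintegral_union_le _ _ _).trans_lt ?_, lt_top_iff_ne_top.2 hfin⟩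
    rw [hnull, zero_add]
    exact hmid
  exact hlt.ne hvar

lemma IsLevyMeasure.integrableOn_id_Icc (hν : IsLevyMeasure ν) {r : ℝ} (hr : 0 < r) :
    IntegrableOn (fun z : ℝ => z) (Icc r 1) ν := by
  refine Measure.integrableOn_of_bounded (M := 1) ?_ (by fun_prop) ?_
  · refine ((measure_mono fun z hz => ?_).trans_lt (hν.measure_le_abs_lt_top hr)).ne
    exact hz.1.trans (le_abs_self z)
  · refine (ae_restrict_iff' measurableSet_Icc).2 (Eventually.of_forall fun z hz => ?_)
    rw [Real.norm_eq_abs, abs_of_pos (hr.trans_le hz.1)]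
    exact hz.2

/-- Under one-sided infinite variation, truncated first moments are arbitrarily large. -/
lemma IsLevyMeasure.exists_lt_integral_Icc (hν : IsLevyMeasure ν)
    (htop : ∫⁻ z in Ioc 0 1, ENNReal.ofReal z ∂ν = ⊤) (L : ℝ) {r₀ : ℝ} (hr₀ : 0 < r₀) :
    ∃ r, 0 < r ∧ r ≤ r₀ ∧ L < ∫ z in Icc r 1, z ∂ν := by
  have hU : (⋃ n : ℕ, Icc (1 / ((n : ℝ) + 1)) 1) = Ioc 0 1 := by
    ext z
    simp only [mem_iUnion, mem_Icc, mem_Ioc]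
    constructor
    · rintro ⟨n, h1, h2⟩
      exact ⟨(Nat.one_div_pos_of_nat).trans_le h1, h2⟩
    · rintro ⟨h1, h2⟩
      obtain ⟨n, hn⟩ := exists_nat_one_div_lt h1
      exact ⟨n, hn.le, h2⟩
  have hmono : Monotone fun n : ℕ => Icc (1 / ((n : ℝ) + 1)) 1 := fun m n hmn =>
    Icc_subset_Icc_left (Nat.one_div_le_one_div hmn)
  rw [← hU, setLIntegral_iUnion_of_directed _ hmono.directed_le] at htop
  obtain ⟨n, hn⟩ := lt_iSup_iff.1 (htop ▸ ENNReal.ofReal_lt_top (r := L))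
  have hn0 : 0 < 1 / ((n : ℝ) + 1) := Nat.one_div_pos_of_nat
  refine ⟨min (1 / ((n : ℝ) + 1)) r₀, lt_min hn0 hr₀, min_le_right _ _, ?_⟩
  have hpos : 0 < min (1 / ((n : ℝ) + 1)) r₀ := lt_min hn0 hr₀
  have h1 := hn.trans_le (lintegral_mono_set (f := fun z => ENNReal.ofReal z) (μ := ν)
    (Icc_subset_Icc_left (min_le_left (1 / ((n : ℝ) + 1)) r₀)))
  rw [← ofReal_integral_eq_lintegral_ofReal (hν.integrableOn_id_Icc hpos)
    ((ae_restrict_iff' measurableSet_Icc).2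
      (Eventually.of_forall fun z hz => hpos.le.trans hz.1))] at h1
  exact not_le.1 fun h => not_le.2 h1 (ENNReal.ofReal_le_ofReal h)

/-! ### The barrier at a left boundary point -/

/-- With infinite variation carried by the small positive jumps, there is a smooth barrier
vanishing at `a`, negative only in a left neighbourhood of `a`, with negative generator at `a`. -/
lemma IsLevyMeasure.exists_barrier (hν : IsLevyMeasure ν)
    (hvar : ∫⁻ z in {z : ℝ | |z| ≤ 1}, ENNReal.ofReal |z| ∂ν = ⊤)
    {δ : ℝ} (hδ : 0 < δ) (hneg : ν (Ioo (-δ) 0) = 0) (a : ℝ) :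
    ∃ r, 0 < r ∧ ∃ h : ℝ → ℝ, ContDiff ℝ 2 h ∧ (∀ x, |h x| ≤ r) ∧ h a = 0 ∧
      (∀ x, x ≤ a - r ∨ a ≤ x → 0 ≤ h x) ∧ generator ν h a < 0 := by
  obtain ⟨r, hr, hr₀, hL⟩ := hν.exists_lt_integral_Icc (hν.lintegral_Ioc_eq_top hvar hδ hneg)
    (ν.real {z : ℝ | δ ≤ |z|} - a) (lt_min hδ one_pos)
  have hrδ : r ≤ δ := hr₀.trans (min_le_left _ _)
  have hr1 : r ≤ 1 := hr₀.trans (min_le_right _ _)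
  let b : ContDiffBump (0 : ℝ) := ⟨r / 2, r, by linarith, by linarith⟩
  have hbz : ∀ z : ℝ, r ≤ |z| → b z = 0 := fun z hz =>
    b.zero_of_le_dist (by rwa [dist_zero_right, Real.norm_eq_abs])
  have hsm : ContDiff ℝ 2 fun x => (x - a) * b (x - a) :=
    (contDiff_id.sub contDiff_const).mul (b.contDiff.comp (contDiff_id.sub contDiff_const))
  have hbd : ∀ x, |(x - a) * b (x - a)| ≤ r := by
    intro x
    rw [abs_mul, abs_of_nonneg b.nonneg]
    rcases le_total r |x - a| with h | h
    · rw [hbz _ h, mul_zero]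
      exact hr.le
    · exact (mul_le_of_le_one_right (abs_nonneg _) b.le_one).trans h
  have hb0 : b 0 = 1 := b.one_of_mem_closedBall (Metric.mem_closedBall_self (by
    change 0 ≤ r / 2
    linarith))
  have hder : deriv (fun x => (x - a) * b (x - a)) a = 1 := by
    have h1 : HasDerivAt (fun x => x - a) 1 a := (hasDerivAt_id a).sub_const a
    have h2 : DifferentiableAt ℝ (fun x => b (x - a)) a :=
      (b.contDiff (n := 1).comp (contDiff_id.sub contDiff_const)).differentiable one_ne_zero a
    have := (h1.mul h2.hasDerivAt).deriv
    simp only [sub_self, hb0, zero_mul, add_zero, mul_one] at this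
    exact this
  have hj : jumpIntegrand (fun x => (x - a) * b (x - a)) a
      = fun z => z * b z - {z : ℝ | |z| ≤ 1}.indicator (fun z => z) z := by
    ext z
    simp only [jumpIntegrand, hder, add_sub_cancel_left, sub_self, zero_mul, sub_zero, one_mul]
  have hi := hν.integrable_jumpIntegrand hsm hbd a
  have hfin : IntegrableOn (fun _ : ℝ => (1 : ℝ)) {z : ℝ | δ ≤ |z|} ν :=
    MeasureTheory.integrableOn_const (hν.measure_le_abs_lt_top hδ).ne
  have hle : ∫ z, jumpIntegrand (fun x => (x - a) * b (x - a)) a z ∂ν ≤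
      ν.real {z : ℝ | δ ≤ |z|} - ∫ z in Icc r 1, z ∂ν := by
    calc ∫ z, jumpIntegrand (fun x => (x - a) * b (x - a)) a z ∂ν
        ≤ ∫ z, ({z : ℝ | δ ≤ |z|}.indicator (fun _ => (1 : ℝ)) z
            - (Icc r 1).indicator (fun z => z) z) ∂ν := by
          refine integral_mono_ae hi ((hfin.integrable_indicator (measurableSet_le_abs δ)).sub
            ((hν.integrableOn_id_Icc hr).integrable_indicator measurableSet_Icc)) ?_
          filter_upwards [measure_eq_zero_iff_ae_notMem.1 hneg] with z hz
          have hind : 0 ≤ {z : ℝ | δ ≤ |z|}.indicator (fun _ => (1 : ℝ)) z :=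
            indicator_nonneg (fun _ _ => zero_le_one) z
          simp only [hj]
          rcases lt_or_ge z 0 with h0 | h0
          · have hzδ : δ ≤ |z| := by
              rw [abs_of_neg h0]
              by_contra hcon
              exact hz ⟨by linarith, h0⟩
            rw [hbz z (hrδ.trans hzδ), indicator_of_mem (show z ∈ {z : ℝ | δ ≤ |z|} from hzδ),
              indicator_of_notMem (show z ∉ Icc r 1 from fun h => by linarith [h.1])]
            by_cases hz1 : |z| ≤ 1
            · rw [indicator_of_mem (show z ∈ {z : ℝ | |z| ≤ 1} from hz1)]
              linarith [(abs_le.1 hz1).1]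
            · rw [indicator_of_notMem (show z ∉ {z : ℝ | |z| ≤ 1} from hz1)]
              norm_num
          · have habs : |z| = z := abs_of_nonneg h0
            rcases lt_or_ge z r with hzr | hzr
            · rw [indicator_of_notMem (show z ∉ Icc r 1 from fun h => by linarith [h.1]),
                indicator_of_mem (show z ∈ {z : ℝ | |z| ≤ 1} from by
                  change |z| ≤ 1
                  linarith)]
              have := mul_le_of_le_one_right h0 (b.le_one (x := z))
              linarith
            · rw [hbz z (by rwa [habs])]
              by_cases hz1 : z ≤ 1
              · rw [indicator_of_mem (show z ∈ Icc r 1 from ⟨hzr, hz1⟩),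
                  indicator_of_mem (show z ∈ {z : ℝ | |z| ≤ 1} from habs.trans_le hz1)]
                linarith
              · rw [indicator_of_notMem (show z ∉ Icc r 1 from fun h => hz1 h.2),
                  indicator_of_notMem (show z ∉ {z : ℝ | |z| ≤ 1} from
                    fun h => hz1 (habs.symm.trans_le h))]
                linarith
      _ = ν.real {z : ℝ | δ ≤ |z|} - ∫ z in Icc r 1, z ∂ν := by
          rw [integral_sub (hfin.integrable_indicator (measurableSet_le_abs δ))
            ((hν.integrableOn_id_Icc hr).integrable_indicator measurableSet_Icc),
            integral_indicator (measurableSet_le_abs δ), integral_indicator measurableSet_Icc]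
          simp
  refine ⟨r, hr, _, hsm, hbd, by simp, ?_, ?_⟩
  · rintro x (hx | hx)
    · rw [hbz _ (by rw [abs_of_nonpos (by linarith)]; linarith), mul_zero]
    · exact mul_nonneg (by linarith) b.nonneg
  · rw [generator, hder]
    linarith

/-- With infinite variation carried by the small positive jumps, the set where a subsolution
is maximal has no leftmost point. -/
lemma IsViscositySubsolution.not_forall_lt (hν : IsLevyMeasure ν)
    (hvar : ∫⁻ z in {z : ℝ | |z| ≤ 1}, ENNReal.ofReal |z| ∂ν = ⊤)
    {δ : ℝ} (hδ : 0 < δ) (hneg : ν (Ioo (-δ) 0) = 0) (hV : IsViscositySubsolution ν V) {a : ℝ}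
    (hmax : ∀ x, V x ≤ V a) : ¬ ∀ x < a, V x < V a := by
  intro hlt
  obtain ⟨r, hr, h, hsm, hbd, ha, hpos, hgen⟩ := hν.exists_barrier hvar hδ hneg a
  obtain ⟨ρ₀, hρ₀, hball⟩ := Metric.eventually_nhds_iff_ball.1
    ((hν.continuous_generator hsm hbd).continuousAt.eventually_lt_const hgen)
  set ρ := min (ρ₀ / 2) r
  have hρ : 0 < ρ := lt_min (by linarith) hr
  have hρr : ρ ≤ r := min_le_right _ _
  have hρ1 : ρ < ρ₀ := (min_le_left _ _).trans_lt (by linarith)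
  obtain ⟨m, hm, hmm⟩ := (hV.1.upperSemicontinuousOn (Icc (a - r) (a - ρ))).exists_isMaxOn
    (nonempty_Icc.2 (by linarith)) isCompact_Icc
  have hma : V m < V a := hlt m (by linarith [hm.2])
  set ε := (V a - V m) / (2 * r)
  have hε : 0 < ε := div_pos (by linarith) (by linarith)
  have hεr : ε * r = (V a - V m) / 2 := by
    simp only [ε]
    field_simp
  have husc : UpperSemicontinuous fun x => V x - (V a + ε * h x) := by
    have hc := hsm.continuous
    simpa only [sub_eq_add_neg] using
      hV.1.add (show Continuous fun x => -(V a + ε * h x) by fun_prop).upperSemicontinuous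
  obtain ⟨y, hy, hymax⟩ := (husc.upperSemicontinuousOn (Icc (a - ρ) a)).exists_isMaxOn
    (nonempty_Icc.2 (by linarith)) isCompact_Icc
  have hya : V a - (V a + ε * h a) ≤ V y - (V a + ε * h y) :=
    hymax (show a ∈ Icc (a - ρ) a from ⟨by linarith, le_rfl⟩)
  rw [ha] at hya
  have hglob : ∀ x, V x - (V a + ε * h x) ≤ V y - (V a + ε * h y) := by
    intro x
    by_cases hx : x ≤ a - r ∨ a ≤ x
    · have := mul_nonneg hε.le (hpos x hx)
      linarith [hmax x]
    · obtain ⟨hx1, hx2⟩ := not_or.1 hx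
      rw [not_le] at hx1 hx2
      rcases le_total x (a - ρ) with hxρ | hxρ
      · have h1 : V x ≤ V m := hmm (show x ∈ Icc (a - r) (a - ρ) from ⟨hx1.le, hxρ⟩)
        have h2 := mul_le_mul_of_nonneg_left (abs_le.1 (hbd x)).1 hε.le
        linarith
      · exact hymax (show x ∈ Icc (a - ρ) a from ⟨hxρ, hx2.le⟩)
  have h1 := hV.generator_nonneg hsm (hν.integrable_jumpIntegrand hsm hbd y) hε hglob
  have h2 : generator ν h y < 0 := hball y (by
    rw [Metric.mem_ball, Real.dist_eq, abs_lt]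
    constructor <;> linarith [hy.1, hy.2])
  linarith

/-! ### Reflection -/

lemma lintegral_map_neg_of_symmetric {S : Set ℝ} (hS : MeasurableSet S)
    (hsymm : Neg.neg ⁻¹' S = S) {g : ℝ → ENNReal} (hg : Measurable g)
    (hsg : ∀ z, g (-z) = g z) :
    ∫⁻ z in S, g z ∂(ν.map Neg.neg) = ∫⁻ z in S, g z ∂ν := by
  rw [setLIntegral_map hS hg measurable_neg, hsymm]
  simp only [hsg]

lemma IsLevyMeasure.map_neg (hν : IsLevyMeasure ν) : IsLevyMeasure (ν.map Neg.neg) where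
  zero_mass := by
    rw [Measure.map_apply measurable_neg (measurableSet_singleton 0)]
    simpa using hν.zero_mass
  integrability := by
    rw [lintegral_map_neg_of_symmetric (measurableSet_lt (by fun_prop) (by fun_prop))
      (by ext; simp) (by fun_prop) (by simp),
      Measure.map_apply measurable_neg (measurableSet_le_abs 1)]
    simpa using hν.integrability

lemma jumpIntegrand_comp_neg (y z : ℝ) :
    jumpIntegrand (fun x => φ (-x)) (-y) z = jumpIntegrand φ y (-z) := by
  have hd : deriv (fun x => φ (-x)) (-y) = -deriv φ y := by
    rw [deriv_comp_neg, neg_neg]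
  simp only [jumpIntegrand, hd, neg_add, neg_neg]
  by_cases hz : |z| ≤ 1
  · simp [indicator, hz]
  · simp [indicator, hz]

lemma IsViscositySubsolution.comp_neg (hV : IsViscositySubsolution ν V) :
    IsViscositySubsolution (ν.map Neg.neg) (fun x => V (-x)) := by
  refine ⟨hV.1.comp continuous_neg, fun φ y hφ hi hmax => ?_⟩
  have hj : jumpIntegrand (fun x => φ (-x)) (-y) = fun z => jumpIntegrand φ y (-z) :=
    funext fun z => jumpIntegrand_comp_neg y z
  have h1 := hV.2 (fun x => φ (-x)) (-y) (hφ.comp contDiff_neg)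
    (by
      rw [hj]
      exact (MeasurableEquiv.neg ℝ).measurableEmbedding.integrable_map_iff.1 hi)
    (fun x => by simpa using hmax (-x))
  have h2 : generator (ν.map Neg.neg) φ y = generator ν (fun x => φ (-x)) (-y) := by
    rw [generator, generator, hj, deriv_comp_neg, neg_neg]
    congr 1
    · ring
    · exact (MeasurableEquiv.neg ℝ).measurableEmbedding.integral_map _
  rwa [h2]

/-- With infinite variation carried by the small negative jumps, the set where a subsolution
is maximal has no rightmost point. -/
lemma IsViscositySubsolution.not_forall_gt (hν : IsLevyMeasure ν)
    (hvar : ∫⁻ z in {z : ℝ | |z| ≤ 1}, ENNReal.ofReal |z| ∂ν = ⊤)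
    {δ : ℝ} (hδ : 0 < δ) (hpos : ν (Ioo 0 δ) = 0) (hV : IsViscositySubsolution ν V) {a : ℝ}
    (hmax : ∀ x, V x ≤ V a) : ¬ ∀ x > a, V x < V a := by
  intro hlt
  refine hV.comp_neg.not_forall_lt (a := -a) hν.map_neg ?_ hδ ?_ ?_ ?_
  · rw [lintegral_map_neg_of_symmetric (measurableSet_abs_le 1) (by ext; simp) (by fun_prop)
      (by simp)]
    exact hvar
  · rw [Measure.map_apply measurable_neg measurableSet_Ioo]
    simpa using hpos
  · intro x
    simpa using hmax (-x)
  · intro x hx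
    simpa using hlt (-x) (by linarith)

/-! ### The Liouville property -/

lemma exists_mem_support_of_measure_ne_zero {S : Set ℝ} (h : ν S ≠ 0) : ∃ t ∈ ν.support, t ∈ S := by
  obtain ⟨t, ht⟩ := Measure.nonempty_inter_support_of_pos (pos_iff_ne_zero.2 h)
  exact ⟨t, ht.2, ht.1⟩

/-- Bounded subsolutions are constant. -/
theorem IsViscositySubsolution.exists_eq_const (hν : IsLevyMeasure ν) {p : ℝ}
    (hA1 : Nondegenerate ν p) (hA3 : HasMomentAtInfinity ν)
    (hA2 : p ∈ Ioo (1 : ℝ) 2 ∨ SupportCovers ν) (hV : IsViscositySubsolution ν V)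
    {K : ℝ} (hK : ∀ y, V y ≤ K) : ∃ c, ∀ y, V y = c := by
  obtain ⟨m, hm⟩ := hV.exists_forall_le hν hA3 hK
  refine ⟨V m, ?_⟩
  set S := {x | V x = V m}
  have hmS : m ∈ S := rfl
  have hS : IsClosed S := by
    have : S = V ⁻¹' Ici (V m) := by
      ext x
      exact ⟨fun h => ge_of_eq h, fun h => le_antisymm (hm x) h⟩
    rw [this]
    exact hV.1.isClosed_preimage (V m)
  have hmax : ∀ y ∈ S, ∀ x, V x ≤ V y := fun y (hy : V y = V m) x => hy ▸ hm x
  have hST : ∀ y ∈ S, ∀ t ∈ ν.support, y + t ∈ S := fun y hy t ht =>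
    (hV.eq_of_mem_support hν (hmax y hy) ht).trans hy
  suffices h : ∀ x, x ∈ S from h
  rcases hA2 with hp | hcov
  · have hvar := hA1.lintegral_abs_eq_top hp.1
    have hup : (∀ δ > 0, ν (Ioo 0 δ) ≠ 0) → ∀ y ∈ S, ∀ x, y ≤ x → x ∈ S := fun h y hy x hyx =>
      mem_of_le_of_small_steps hS hST
        (fun δ hδ => exists_mem_support_of_measure_ne_zero (h δ hδ)) hy hyx
    have hdown : (∀ δ > 0, ν (Ioo (-δ) 0) ≠ 0) → ∀ y ∈ S, ∀ x, x ≤ y → x ∈ S :=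
      fun h y hy x hxy => mem_of_ge_of_small_steps hS hST
        (fun δ hδ => exists_mem_support_of_measure_ne_zero (h δ hδ)) hy hxy
    by_cases hP : ∀ δ > 0, ν (Ioo 0 δ) ≠ 0
    · intro x
      by_cases hN : ∀ δ > 0, ν (Ioo (-δ) 0) ≠ 0
      · rcases le_total m x with h | h
        · exact hup hP m hmS x h
        · exact hdown hN m hmS x h
      · push Not at hN
        obtain ⟨δ, hδ, hneg⟩ := hN
        by_contra hx
        have hbdd : BddBelow S := ⟨x, fun y hy => le_of_not_ge fun h => hx (hup hP y hy x h)⟩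
        have ha := hS.csInf_mem ⟨m, hmS⟩ hbdd
        refine hV.not_forall_lt hν hvar hδ hneg (hmax _ ha) fun t ht => ?_
        refine lt_of_le_of_ne (hmax _ ha t) fun h => ?_
        exact absurd (csInf_le hbdd (show t ∈ S from h.trans ha)) (not_le.2 ht)
    · push Not at hP
      obtain ⟨δ, hδ, hpos⟩ := hP
      have hN : ∀ ε > 0, ν (Ioo (-ε) 0) ≠ 0 := by
        intro ε hε hneg
        have hsub : Ioc (0 : ℝ) 1 ⊆ Ioo 0 δ ∪ Icc δ 1 := fun z hz =>
          (lt_or_ge z δ).imp (fun h => ⟨hz.1, h⟩) fun h => ⟨h, hz.2⟩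
        refine ((lintegral_mono_set hsub).trans_lt ((lintegral_union_le _ _ _).trans_lt ?_)).ne
          (hν.lintegral_Ioc_eq_top hvar hε hneg)
        rw [setLIntegral_measure_zero _ _ hpos, zero_add]
        exact (hν.integrableOn_id_Icc hδ).lintegral_lt_top
      intro x
      by_contra hx
      have hbdd : BddAbove S := ⟨x, fun y hy => le_of_not_ge fun h => hx (hdown hN y hy x h)⟩
      have ha := hS.csSup_mem ⟨m, hmS⟩ hbdd
      refine hV.not_forall_gt hν hvar hδ hpos (hmax _ ha) fun t ht => ?_
      refine lt_of_le_of_ne (hmax _ ha t) fun h => ?_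
      exact absurd (le_csSup hbdd (show t ∈ S from h.trans ha)) (not_le.2 ht)
  · intro x
    obtain ⟨n, hn⟩ := mem_iUnion.1 (hcov ▸ mem_univ (x - m) : x - m ∈ ⋃ n, nfoldSum ν.support n)
    simpa using add_mem_of_mem_nfoldSum hST n _ hn m hmS

lemma IsViscositySupersolution.neg (hV : IsViscositySupersolution ν V) :
    IsViscositySubsolution ν (fun x => -V x) := by
  refine ⟨fun y c hc => ?_, fun φ y hφ hi hmax => ?_⟩
  · filter_upwards [hV.1 y (-c) (by linarith)] with x hx
    linarith
  · have hd := hφ.differentiable two_ne_zero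
    have h1 := hV.2 (fun x => 0 + -1 * φ x) y (contDiff_const.add (contDiff_const.mul hφ))
      (by rw [jumpIntegrand_const_add_mul hd]; exact hi.const_mul _)
      (fun x => by linarith [hmax x])
    rw [generator_const_add_mul hd] at h1
    linarith

end LevyOU

theorem theorem3p2 (ν : MeasureTheory.Measure ℝ) (hν : LevyOU.IsLevyMeasure ν)
    (p : ℝ) (hA1 : LevyOU.Nondegenerate ν p)
    (hA3 : LevyOU.HasMomentAtInfinity ν)
    (hA2 : p ∈ Set.Ioo (1 : ℝ) 2 ∨ LevyOU.SupportCovers ν) :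
    (∀ V : ℝ → ℝ, (∃ K : ℝ, ∀ y, |V y| ≤ K) → LevyOU.IsViscositySubsolution ν V →
      ∃ c : ℝ, ∀ y, V y = c) ∧
    (∀ V : ℝ → ℝ, (∃ K : ℝ, ∀ y, |V y| ≤ K) → LevyOU.IsViscositySupersolution ν V →
      ∃ c : ℝ, ∀ y, V y = c) := by
  refine ⟨fun V ⟨K, hK⟩ hV => ?_, fun V ⟨K, hK⟩ hV => ?_⟩
  · exact hV.exists_eq_const hν hA1 hA3 hA2 fun y => (le_abs_self _).trans (hK y)
  · obtain ⟨c, hc⟩ := hV.neg.exists_eq_const hν hA1 hA3 hA2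
      fun y => (neg_le_abs _).trans (hK y)
    exact ⟨-c, fun y => by linarith [hc y]⟩
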